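/- Let $Q$ be a finite set of states and $A$ a finite alphabet. A probabilistic automaton $\mathcal A$ over $Q$ and $A$ consists of row-stochastic real matrices $(M_a)_{a\in A}$ indexed by $Q\times Q$, an initial state and a set of accepting states. For a word $w=a_1\cdots a_k\in A^*$ put $w(s,t)=(M_{a_1}\cdots M_{a_k})(s,t)$ (the identity matrix if $w$ is empty). Leaks. A word $w$ is idempotent if for all $s,t\in Q$: $w(s,t)>0\iff (ww)(s,t)>0$. In a finite Markov chain, a state $t$ is reachable from $s$ if $t$ is reached from $s$ with non-zero probability in some number $k\ge 0$ of steps, and $s$ is recurrent if $s$ is reachable from every state that is reachable from $s$. A leak from $r\in Q$ to $q\in Q$ is a sequence $(u_n)_{n\in\mathbb N}$ of idempotent words such that (1) for all $s,t$ the sequence $u_n(s,t)$ converges to some $u(s,t)$; (2) $r$ is recurrent in the Markov chain with transition matrix $u$; (3) $u_n(r,q)>0$ for all $n$; (4) $r$ is not reachable from $q$ in this Markov chain. The automaton $\mathcal A$ is leaktight if it has no leak. Extended Markov monoid. A limit-word is a map $\mathbf u:Q\times Q\to\{0,1\}$ such that for every $s$ there is $t$ with $\mathbf u(s,t)=1$.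 Limit-words are multiplied by concatenation: $(\mathbf u\cdot\mathbf v)(s,t)=1$ iff there is $q$ with $\mathbf u(s,q)=1$ and $\mathbf v(q,t)=1$; the identity $\mathbf 1$ is given by $\mathbf 1(s,t)=1\iff s=t$. If $\mathbf u=\mathbf u\cdot\mathbf u$ is idempotent, a state $s$ is $\mathbf u$-recurrent if $\mathbf u(s,t)=1$ implies $\mathbf u(t,s)=1$ for all $t$, and the iteration $\mathbf u^\sharp$ is given by $\mathbf u^\sharp(s,t)=1$ iff $\mathbf u(s,t)=1$ and $t$ is $\mathbf u$-recurrent. Each letter $a$ induces the limit-word $\mathbf a$ with $\mathbf a(s,t)=1\iff M_a(s,t)>0$. The extended Markov monoid of $\mathcal A$ is the smallest set of pairs of limit-words that contains $(\mathbf 1,\mathbf 1)$ and $(\mathbf a,\mathbf a)$ for $a\in A$, is closed under the componentwise product, and contains $(\mathbf u^\sharp,\mathbf u_+)$ whenever it contains $(\mathbf u,\mathbf u_+)$ with $\mathbf u$ and $\mathbf u_+$ both idempotent. A pair $(\mathbf u,\mathbf u_+)$ is a leak witness if $\mathbf u$ and $\mathbf u_+$ are idempotent and there are $r,q\in Q$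 such that $r$ is $\mathbf u$-recurrent, $\mathbf u_+(r,q)=1$ and $\mathbf u(q,r)=0$. Theorem. A probabilistic automaton $\mathcal A$ is leaktight if and only if its extended Markov monoid contains no leak witness. Consequently, leaktightness depends only on which transition probabilities are positive: if $\mathcal A$ and $\mathcal B$ are probabilistic automata over the same $Q$ and $A$, with transition matrices $(M_a)$ and $(N_a)$, such that $M_a(s,t)>0\iff N_a(s,t)>0$ for all $a\in A$ and $s,t\in Q$, then $\mathcal A$ is leaktight if and only if $\mathcal B$ is leaktight. -/

import Mathlib

/-- A probabilistic automaton with state set `Q` and input alphabet `A`: one row-stochastic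
transition matrix per letter, an initial state and a set of accepting states. -/
structure ProbAutomaton (Q A : Type*) [Fintype Q] [DecidableEq Q] where
  /-- `trans a s t` is the probability to go from `s` to `t` when reading the letter `a`. -/
  trans : A → Matrix Q Q ℝ
  trans_stochastic : ∀ a, trans a ∈ Matrix.rowStochastic ℝ Q
  init : Q
  accept : Set Q

/-- In the finite Markov chain with transition matrix `P`, the state `t` is reached from `s`
with non-zero probability. -/
def ChainReachable {Q : Type*} [Fintype Q] [DecidableEq Q] (P : Matrix Q Q ℝ) (s t : Q) : Prop :=
  ∃ k : ℕ, 0 < (P ^ k) s t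

/-- The state `s` is recurrent in the finite Markov chain with transition matrix `P`. -/
def ChainRecurrent {Q : Type*} [Fintype Q] [DecidableEq Q] (P : Matrix Q Q ℝ) (s : Q) : Prop :=
  ∀ t, ChainReachable P s t → ChainReachable P t s

namespace ProbAutomaton

variable {Q A : Type*} [Fintype Q] [DecidableEq Q]

/-- The matrix of the probabilities `w(s,t)` to go from `s` to `t` when reading the word `w`. -/
def wordMatrix (𝒜 : ProbAutomaton Q A) (w : List A) : Matrix Q Q ℝ :=
  (w.map 𝒜.trans).prod

/-- Idempotent words: reading `w` once or twice allows the same transitions. -/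
def IsIdempotentWord (𝒜 : ProbAutomaton Q A) (w : List A) : Prop :=
  ∀ s t, 0 < 𝒜.wordMatrix w s t ↔ 0 < 𝒜.wordMatrix (w ++ w) s t

/-- The sequence of words `u` is a leak from the state `r` to the state `q`. -/
def IsLeak (𝒜 : ProbAutomaton Q A) (u : ℕ → List A) (r q : Q) : Prop :=
  (∀ n, 𝒜.IsIdempotentWord (u n)) ∧
  ∃ P : Matrix Q Q ℝ,
    (∀ s t, Filter.Tendsto (fun n => 𝒜.wordMatrix (u n) s t) Filter.atTop (nhds (P s t))) ∧
    ChainRecurrent P r ∧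
    (∀ n, 0 < 𝒜.wordMatrix (u n) r q) ∧
    ¬ ChainReachable P q r

/-- An automaton is leaktight if it has no leak. -/
def Leaktight (𝒜 : ProbAutomaton Q A) : Prop :=
  ¬ ∃ (u : ℕ → List A) (r q : Q), 𝒜.IsLeak u r q

end ProbAutomaton

/-- A limit-word: a `{0,1}`-valued map on pairs of states without a zero row. The equation
`u(s,t) = 1` is written `u.edge s t`, and `u(s,t) = 0` is `¬ u.edge s t`. -/
@[ext]
structure LimitWord (Q : Type*) where
  edge : Q → Q → Prop
  exists_edge : ∀ s, ∃ t, edge s t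

namespace LimitWord

variable {Q : Type*}

/-- The identity limit-word. -/
instance : One (LimitWord Q) := ⟨⟨fun s t => s = t, fun s => ⟨s, rfl⟩⟩⟩

/-- Concatenation of limit-words. -/
instance : Mul (LimitWord Q) :=
  ⟨fun u v => ⟨fun s t => ∃ q, u.edge s q ∧ v.edge q t, fun s => by
    obtain ⟨q, hq⟩ := u.exists_edge s
    obtain ⟨t, ht⟩ := v.exists_edge q
    exact ⟨t, q, hq, ht⟩⟩⟩

theorem one_edge (s t : Q) : (1 : LimitWord Q).edge s t ↔ s = t := Iff.rfl

theorem mul_edge (u v : LimitWord Q) (s t : Q) :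
    (u * v).edge s t ↔ ∃ q, u.edge s q ∧ v.edge q t := Iff.rfl

instance : Monoid (LimitWord Q) where
  mul_assoc u v w := by
    ext s t
    simp only [mul_edge]
    constructor
    · rintro ⟨q, ⟨p, h1, h2⟩, h3⟩
      exact ⟨p, h1, q, h2, h3⟩
    · rintro ⟨p, h1, q, h2, h3⟩
      exact ⟨q, ⟨p, h1, h2⟩, h3⟩
  one_mul u := by
    ext s t
    simp [mul_edge, one_edge]
  mul_one u := by
    ext s t
    simp [mul_edge, one_edge]

/-- The state `s` is `u`-recurrent (used for idempotent limit-words `u`). -/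
def Recurrent (u : LimitWord Q) (s : Q) : Prop :=
  ∀ t, u.edge s t → u.edge t s

theorem edge_trans {u : LimitWord Q} (hu : IsIdempotentElem u) {s t q : Q}
    (h1 : u.edge s t) (h2 : u.edge t q) : u.edge s q := by
  have h : (u * u).edge s q := ⟨t, h1, h2⟩
  rwa [hu.eq] at h

theorem exists_edge_recurrent [Finite Q] {u : LimitWord Q} (hu : IsIdempotentElem u) (s : Q) :
    ∃ t, u.edge s t ∧ u.Recurrent t := by
  let R : Q → Q → Prop := fun y x => u.edge x y ∧ ¬ u.edge y x
  have : IsTrans Q R := ⟨fun a b c hab hbc =>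
    ⟨edge_trans hu hbc.1 hab.1, fun h => hab.2 (edge_trans hu h hbc.1)⟩⟩
  have : Std.Irrefl R := ⟨fun a h => h.2 h.1⟩
  have wf : WellFounded R := Finite.wellFounded_of_trans_of_irrefl R
  obtain ⟨t, ht, hmin⟩ := wf.has_min {t | u.edge s t} (u.exists_edge s)
  refine ⟨t, ht, fun t' htt' => ?_⟩
  by_contra h
  exact hmin t' (edge_trans hu ht htt') ⟨htt', h⟩

/-- The iteration of an idempotent limit-word: it keeps the edges into recurrent states. -/
def iterate [Finite Q] (u : LimitWord Q) (hu : IsIdempotentElem u) : LimitWord Q where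
  edge s t := u.edge s t ∧ u.Recurrent t
  exists_edge s := exists_edge_recurrent hu s

/-- Leak witnesses among the extended limit-words, that is, the pairs of limit-words
(multiplied componentwise). -/
def IsLeakWitness (p : LimitWord Q × LimitWord Q) : Prop :=
  IsIdempotentElem p ∧
    ∃ r q, p.1.Recurrent r ∧ p.2.edge r q ∧ ¬ p.1.edge q r

end LimitWord

namespace ProbAutomaton

variable {Q A : Type*} [Fintype Q] [DecidableEq Q]

/-- The limit-word induced by a letter. -/
def letter (𝒜 : ProbAutomaton Q A) (a : A) : LimitWord Q where
  edge s t := 0 < 𝒜.trans a s t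
  exists_edge s := by
    obtain ⟨h0, h1⟩ := Matrix.mem_rowStochastic_iff_sum.mp (𝒜.trans_stochastic a)
    by_contra! h
    have h2 : ∑ t, 𝒜.trans a s t ≤ 0 := Finset.sum_nonpos fun t _ => h t
    rw [h1 s] at h2
    linarith

/-- Membership in the extended Markov monoid, the smallest set of extended limit-words that
contains `(1,1)` and the pairs `(a,a)` and is closed under concatenation and iteration. -/
inductive MemExtended (𝒜 : ProbAutomaton Q A) : LimitWord Q × LimitWord Q → Prop
  | letter (a : A) : MemExtended 𝒜 (𝒜.letter a, 𝒜.letter a)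
  | one : MemExtended 𝒜 (1, 1)
  | mul {p p' : LimitWord Q × LimitWord Q} :
      MemExtended 𝒜 p → MemExtended 𝒜 p' → MemExtended 𝒜 (p * p')
  | iterate {u v : LimitWord Q} (hu : IsIdempotentElem u) (hv : IsIdempotentElem v) :
      MemExtended 𝒜 (u, v) → MemExtended 𝒜 (u.iterate hu, v)

/-- The extended Markov monoid. -/
def extendedMarkovMonoid (𝒜 : ProbAutomaton Q A) : Submonoid (LimitWord Q × LimitWord Q) where
  carrier := {p | 𝒜.MemExtended p}
  one_mem' := MemExtended.one
  mul_mem' := MemExtended.mul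

end ProbAutomaton

/-! A leak witness `(u, v)` yields a leak by compactness. By induction over the extended Markov
monoid, each pair `(u, v)` is realised by a stochastic matrix with support `u` that is a limit of
matrices of words with support exactly `v`. For the iteration, powers of a matrix with idempotent
support have a limit point whose support is the iteration (`exists_tendsto_pow_hasSupport_iterate`),
because the mass of the transient states decays.

The converse needs a lower bound independent of the length of the word. If there is no leak witness,
there is `c > 0` such that each word `w` has a pair `(u, v)` in the monoid where `v` is the support
of `w` and `w(s,t) ≥ c` along all edges of `u` (`exists_uniform_lower_bound`). A binary product at
worst squares the bound. Thanks to the absence of leak witnesses, so does the product of arbitrarily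
many words sharing an idempotent pair, once that pair is iterated. It remains to evaluate every word
by a bounded number of nested operations. This is a variant of Simon's factorization forest theorem
(`exists_uniform_cost`), proved by induction on the size of two-sided ideals.

Given a leak, some pair `(u, v)` then occurs infinitely often along it. The limit chain `P`
satisfies `u ⊆ supp P ⊆ v`, and a power of `(u, v)` is a leak witness. Finally, the monoid depends
only on the supports of the letters. -/

namespace FactorizationForest

/-! ### Ideals and idempotents in a finite monoid. -/

section FiniteMonoid

variable {M : Type*} [Monoid M] [Finite M]

theorem exists_pow_isIdempotentElem (g : M) : ∃ n, 0 < n ∧ IsIdempotentElem (g ^ n) := by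
  obtain ⟨i, j, hij, h⟩ := Finite.exists_ne_map_eq_of_infinite (fun n : ℕ => g ^ n)
  wlog hlt : i < j generalizing i j
  · exact this j i hij.symm h.symm (by omega)
  obtain ⟨n, rfl⟩ := Nat.exists_eq_add_of_lt hlt
  have step : ∀ a m : ℕ, g ^ (i + a + m * (n + 1)) = g ^ (i + a) := by
    intro a m
    induction m with
    | zero => simp
    | succ m ih =>
      have : i + a + (m + 1) * (n + 1) = (i + n + 1) + (a + m * (n + 1)) := by ring
      rw [this, pow_add, ← h, ← pow_add, ← add_assoc, ih]
  -- The powers have period `n + 1` from exponent `i` on, so a multiple of the period that is at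
  -- least `i` works.
  refine ⟨(i + 1) * (n + 1), by positivity, ?_⟩
  have hk : (i + 1) * (n + 1) = i + (i * n + n + 1) := by ring
  have := step (i * n + n + 1) (i + 1)
  rw [← hk, pow_add] at this
  exact this

/-- Since `p * m = p`, one has `m = (x * p) * m * y`, hence `m = (x * p) ^ k * m * y ^ k` for all
`k`. An idempotent power of `x * p` therefore fixes `m` from the left, and in that product `p * m`
shrinks to `p`. -/
theorem exists_eq_mul_left {p m x y : M} (h : p * m = p) (hm : m = x * p * y) :
    ∃ z, m = z * p := by
  obtain ⟨n, hn, hidem⟩ := exists_pow_isIdempotentElem (x * p)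
  have h1 : ∀ k, m = (x * p) ^ k * m * y ^ k := by
    intro k
    induction k with
    | zero => simp
    | succ k ih =>
      have : x * p * m * y = m := by rw [mul_assoc x, h, ← hm]
      calc m = (x * p) ^ k * m * y ^ k := ih
        _ = (x * p) ^ k * (x * p * m * y) * y ^ k := by rw [this]
        _ = (x * p) ^ (k + 1) * m * y ^ (k + 1) := by
          rw [pow_succ, pow_succ']; simp only [mul_assoc]
  obtain ⟨n, rfl⟩ : ∃ n', n = n' + 1 := ⟨n - 1, by omega⟩
  have h2 : (x * p) ^ (n + 1) * m = m := by
    conv_lhs => rw [h1 (n + 1)]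
    conv_rhs => rw [h1 (n + 1)]
    rw [← mul_assoc, ← mul_assoc, hidem.eq]
  refine ⟨(x * p) ^ n * x, ?_⟩
  calc m = (x * p) ^ (n + 1) * m := h2.symm
    _ = (x * p) ^ n * x * p := by rw [pow_succ]; simp only [mul_assoc, h]

theorem exists_eq_mul_right {s m x y : M} (h : m * s = s) (hm : m = x * s * y) :
    ∃ z, m = s * z := by
  have : Finite Mᵐᵒᵖ := Finite.of_equiv M MulOpposite.opEquiv
  obtain ⟨z, hz⟩ := exists_eq_mul_left (M := Mᵐᵒᵖ) (p := .op s) (m := .op m) (x := .op y)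
    (y := .op x) (by rw [← MulOpposite.op_mul, h])
    (by rw [hm]; simp only [MulOpposite.op_mul, mul_assoc])
  exact ⟨z.unop, by simpa using congrArg MulOpposite.unop hz⟩

/-- The number of elements of the principal two-sided ideal `MxM`; it is strictly monotone
on the `J`-order. -/
noncomputable def idealCard (x : M) : ℕ := {z : M | ∃ a b, z = a * x * b}.ncard

theorem idealCard_pos (x : M) : 0 < idealCard x :=
  (Set.ncard_pos (Set.toFinite _)).mpr ⟨x, 1, 1, by simp⟩

theorem idealCard_mul_mul_le (a x b : M) : idealCard (a * x * b) ≤ idealCard x := by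
  refine Set.ncard_le_ncard ?_ (Set.toFinite _)
  rintro z ⟨c, d, rfl⟩
  exact ⟨c * a, b * d, by simp only [mul_assoc]⟩

theorem idealCard_mul_le_right (a x : M) : idealCard (a * x) ≤ idealCard x := by
  simpa using idealCard_mul_mul_le a x 1

theorem idealCard_mul_le_left (x b : M) : idealCard (x * b) ≤ idealCard x := by
  simpa using idealCard_mul_mul_le 1 x b

theorem exists_eq_mul_mul_of_idealCard_le {a x b : M}
    (h : idealCard x ≤ idealCard (a * x * b)) : ∃ c d, x = c * (a * x * b) * d := by
  have hsub : {z : M | ∃ c d, z = c * (a * x * b) * d} ⊆ {z : M | ∃ c d, z = c * x * d} := by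
    rintro z ⟨c, d, rfl⟩
    exact ⟨c * a, b * d, by simp only [mul_assoc]⟩
  have := Set.eq_of_subset_of_ncard_le hsub h (Set.toFinite _)
  have hx : x ∈ {z : M | ∃ c d, z = c * x * d} := ⟨1, 1, by simp⟩
  rw [← this] at hx
  exact hx

/-- `m` lies in the `J`-class of `p * s`, and it stabilises `p` from the right and `s` from
the left. -/
structure Stabilises (p s m : M) : Prop where
  left : p * m = p
  right : m * s = s
  le_mul : idealCard m ≤ idealCard (p * s)

theorem Stabilises.exists_eq_mul {p s m : M} (h : Stabilises p s m) :
    (∃ z, m = z * p) ∧ ∃ z, m = s * z := by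
  have hle : idealCard m ≤ idealCard (p * m * s) := by rw [h.left]; exact h.le_mul
  obtain ⟨c, d, hcd⟩ := exists_eq_mul_mul_of_idealCard_le hle
  rw [h.left] at hcd
  exact ⟨exists_eq_mul_left h.left (x := c) (y := s * d) (by rw [hcd]; simp only [mul_assoc]),
    exists_eq_mul_right h.right (x := c * p) (y := d) (by rw [hcd]; simp only [mul_assoc])⟩

/-- Writing `m = z * p` and `m' = s * z'`, the product `m * m'` equals both `m` and `m'`. This
uniqueness lets all blocks between cuts of the same type share one idempotent. -/
theorem Stabilises.eq {p s m m' : M} (h : Stabilises p s m) (h' : Stabilises p s m') :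
    m = m' := by
  obtain ⟨⟨z, hz⟩, -⟩ := h.exists_eq_mul
  obtain ⟨-, z', hz'⟩ := h'.exists_eq_mul
  have h1 : m * m' = m := by
    conv_lhs => rw [hz, mul_assoc, h'.left, ← hz]
  have h2 : m * m' = m' := by
    conv_lhs => rw [hz', ← mul_assoc, h.right, ← hz']
  rw [← h1, h2]

theorem Stabilises.isIdempotentElem {p s m : M} (h : Stabilises p s m) : IsIdempotentElem m := by
  obtain ⟨⟨z, hz⟩, -⟩ := h.exists_eq_mul
  change m * m = m
  conv_lhs => rw [hz, mul_assoc, ← hz, h.left, ← hz]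

/-- An idempotent below `e` in the `J`-class of `e` equals `e`. -/
theorem eq_of_idealCard_le {e f : M} (hf : IsIdempotentElem f) (hl : e * f = f) (hr : f * e = f)
    (h : idealCard e ≤ idealCard f) : f = e := by
  have h' : idealCard e ≤ idealCard (f * e * 1) := by rwa [hr, mul_one]
  obtain ⟨c, d, hcd⟩ := exists_eq_mul_mul_of_idealCard_le h'
  rw [hr, mul_one] at hcd
  obtain ⟨z, hz⟩ := exists_eq_mul_left hr hcd
  rw [← hl]
  conv_lhs => rw [hz, mul_assoc, hf.eq, ← hz]

end FiniteMonoid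

/-- A notion of words having a value at a given cost: it is stable under binary products and
under the iteration of idempotents, and each of these operations costs one unit. -/
structure CostedEval {M W : Type*} [Monoid M] [Monoid W] (sharp : M → M)
    (T : ℕ → W → M → Prop) : Prop where
  mono : ∀ {k l w x}, k ≤ l → T k w x → T l w x
  mul : ∀ {k w w' x x'}, T k w x → T k w' x' → T (k + 1) (w * w') (x * x')
  iterate : ∀ {k e} {l : List W}, IsIdempotentElem e → 2 ≤ l.length → (∀ w ∈ l, T k w e) →
    T (k + 1) l.prod (sharp e)

/-- The iteration of an idempotent `e` is an idempotent below `e`. -/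
structure IsIteration {M : Type*} [Monoid M] (sharp : M → M) : Prop where
  idem : ∀ {e}, IsIdempotentElem e → IsIdempotentElem (sharp e)
  mul_left : ∀ {e}, IsIdempotentElem e → e * sharp e = sharp e
  mul_right : ∀ {e}, IsIdempotentElem e → sharp e * e = sharp e

/-! ### Bounded-cost evaluation, in the manner of factorization forests. -/

section Collapse

variable {M W : Type*} [Monoid M] [Monoid W] {sharp : M → M} {T : ℕ → W → M → Prop}

/-- All sequences of words with values of ideal cardinality at most `d` collapse at a cost
of `K`. -/
def Collapses (T : ℕ → W → M → Prop) (d K : ℕ) : Prop :=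
  ∀ (k : ℕ) (l : List (W × M)), l ≠ [] → (∀ c ∈ l, T k c.1 c.2 ∧ idealCard c.2 ≤ d) →
    ∃ y, T (k + K) l.prod.1 y ∧ idealCard y ≤ d

/-- Greedy factorisation of a sequence into `Good` blocks, each followed by a word with which
it collapses to a value of smaller ideal cardinality. -/
theorem exists_greedy_factorisation {d k : ℕ} {Good : List (W × M) → Prop} (hnil : Good [])
    (l : List (W × M))
    (hstep : ∀ x ∈ l, ∀ R, Good R → Good (x :: R) ∨
      ∃ y, T k (x :: R).prod.1 y ∧ idealCard y ≤ d) :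
    ∃ R F : List (W × M), Good R ∧ (∀ c ∈ F, T k c.1 c.2 ∧ idealCard c.2 ≤ d) ∧
      l.prod.1 = R.prod.1 * F.prod.1 ∧ (l ≠ [] → R = [] → F ≠ []) := by
  induction l with
  | nil => exact ⟨[], [], hnil, by simp, by simp, by simp⟩
  | cons x l ih =>
    obtain ⟨R, F, hR, hF, hl, -⟩ := ih fun x hx => hstep x (List.mem_cons_of_mem _ hx)
    rcases hstep x List.mem_cons_self R hR with h | ⟨y, hy, hyd⟩
    · exact ⟨x :: R, F, h, hF, by simp [hl, mul_assoc], by simp⟩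
    · refine ⟨[], ((x :: R).prod.1, y) :: F, hnil, ?_, by simp [hl, mul_assoc], by simp⟩
      intro c hc
      rcases List.mem_cons.mp hc with rfl | hc
      exacts [⟨hy, hyd⟩, hF c hc]

/-- A list with a cut satisfying `P` has a first one. -/
theorem exists_first_cut {α : Type*} {P : List α → List α → Prop} {l : List α}
    (h : ∃ l₁ l₂, l = l₁ ++ l₂ ∧ l₁ ≠ [] ∧ l₂ ≠ [] ∧ P l₁ l₂) :
    ∃ l₁ l₂, l = l₁ ++ l₂ ∧ l₁ ≠ [] ∧ l₂ ≠ [] ∧ P l₁ l₂ ∧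
      ∀ m₁ m₂, l₁ = m₁ ++ m₂ → m₁ ≠ [] → m₂ ≠ [] → ¬ P m₁ (m₂ ++ l₂) := by
  classical
  have h' : ∃ n, ∃ l₁ l₂, l = l₁ ++ l₂ ∧ l₁ ≠ [] ∧ l₂ ≠ [] ∧ P l₁ l₂ ∧ l₁.length = n := by
    obtain ⟨l₁, l₂, h⟩ := h
    exact ⟨_, l₁, l₂, h.1, h.2.1, h.2.2.1, h.2.2.2, rfl⟩
  obtain ⟨l₁, l₂, hl, h1, h2, hP, hlen⟩ := Nat.find_spec h'
  refine ⟨l₁, l₂, hl, h1, h2, hP, fun m₁ m₂ hm hm1 hm2 hPm => ?_⟩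
  refine Nat.find_min h' (m := m₁.length) ?_
    ⟨m₁, m₂ ++ l₂, by rw [hl, hm, List.append_assoc], hm1, by simp [hm2], hPm, rfl⟩
  rw [← hlen, hm, List.length_append]
  have := List.length_pos_iff.mpr hm2
  omega

/-- All words inside the context `a, b` collapse, at a cost of `C`, to their product or to a
value of ideal cardinality at most `d`, if the pairs of a prefix and the complementary suffix,
taken with the context, all belong to `Θ`. -/
def SmoothCollapses (T : ℕ → W → M → Prop) (d C : ℕ) (Θ : Set (M × M)) : Prop :=
  ∀ (k : ℕ) (a b : M) (l : List (W × M)), l ≠ [] →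
    (∀ c ∈ l, T k c.1 c.2 ∧ idealCard c.2 ≤ d + 1) → d + 1 ≤ idealCard (a * l.prod.2 * b) →
    (∀ l₁ l₂, l = l₁ ++ l₂ → l₁ ≠ [] → l₂ ≠ [] → (a * l₁.prod.2, l₂.prod.2 * b) ∈ Θ) →
    ∃ y, T (k + C) l.prod.1 y ∧ (y = l.prod.2 ∨ idealCard y ≤ d)

theorem smoothCollapses_empty (T : ℕ → W → M → Prop) (d : ℕ) : SmoothCollapses T d 0 ∅ := by
  intro k a b l hl h _ hcut
  match l, hl with
  | [x], _ => exact ⟨x.2, by simpa using (h x (by simp)).1, .inl (by simp)⟩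
  | x :: x' :: l, _ => exact (hcut [x] (x' :: l) rfl (by simp) (by simp)).elim

variable [Finite M]

theorem IsIteration.eq_or_lt (hs : IsIteration sharp) {e : M} (he : IsIdempotentElem e) :
    sharp e = e ∨ idealCard (sharp e) < idealCard e := by
  by_contra! h
  exact h.1 (eq_of_idealCard_le (hs.idem he) (hs.mul_left he) (hs.mul_right he) h.2)

/-- Each greedy block behind the good prefix collapses to a value of ideal cardinality at most `d`,
so `hK` handles their sequence. One more product attaches the good prefix. -/
theorem exists_collapse_of_greedy (hT : CostedEval sharp T) {d K k : ℕ} (hK : Collapses T d K)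
    {Good : List (W × M) → Prop} {V : M → Prop} (hV : ∀ y, idealCard y ≤ d → V y)
    (hnil : Good []) (hcol : ∀ R, Good R → R ≠ [] → ∃ y, T k R.prod.1 y ∧ V y)
    {l : List (W × M)} (hl : l ≠ [])
    (hstep : ∀ x ∈ l, ∀ R, Good R → Good (x :: R) ∨
      ∃ y, T k (x :: R).prod.1 y ∧ idealCard y ≤ d) :
    ∃ y, T (k + K + 1) l.prod.1 y ∧ V y := by
  obtain ⟨R, F, hR, hF, hprod, hne⟩ := exists_greedy_factorisation hnil l hstep
  rw [hprod]
  by_cases hF0 : F = []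
  · obtain ⟨y, hy, hyV⟩ := hcol R hR fun h => hne hl h hF0
    exact ⟨y, by simpa [hF0] using hT.mono (by omega) hy, hyV⟩
  obtain ⟨z, hz, hzd⟩ := hK k F hF0 hF
  by_cases hR0 : R = []
  · exact ⟨z, by simpa [hR0] using hT.mono (by omega) hz, hV z hzd⟩
  obtain ⟨y, hy, -⟩ := hcol R hR hR0
  exact ⟨y * z, hT.mul (hT.mono (by omega) hy) hz,
    hV _ ((idealCard_mul_le_right y z).trans hzd)⟩

/-- Words whose values are the unique element stabilising `p` and `s`, or have smaller ideal
cardinality, collapse to such a value. -/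
theorem exists_collapse_of_stabilises (hs : IsIteration sharp) (hT : CostedEval sharp T)
    {d K k : ℕ} (hK : Collapses T d K) {p s : M} (hd : idealCard (p * s) ≤ d + 1)
    {l : List (W × M)} (hl : l ≠ [])
    (hval : ∀ c ∈ l, T k c.1 c.2 ∧ (Stabilises p s c.2 ∨ idealCard c.2 ≤ d)) :
    ∃ y, T (k + K + 3) l.prod.1 y ∧ (Stabilises p s y ∨ idealCard y ≤ d) := by
  have hcol : ∀ R : List (W × M), (∀ c ∈ R, T k c.1 c.2 ∧ Stabilises p s c.2) → R ≠ [] →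
      ∃ y, T (k + 1) R.prod.1 y ∧ (Stabilises p s y ∨ idealCard y ≤ d) := by
    intro R hR hR0
    match R, hR, hR0 with
    | [x], hR, _ =>
      obtain ⟨h1, h2⟩ := hR x (by simp)
      exact ⟨x.2, by simpa using hT.mono (by omega) h1, .inl h2⟩
    | x :: x' :: R, hR, _ =>
      have hx := (hR x (by simp)).2
      -- All values in `R` are the same idempotent, so a single iteration evaluates the whole list.
      -- It either keeps the value or lowers its ideal cardinality.
      refine ⟨sharp x.2, ?_, ?_⟩
      · have := hT.iterate (l := (x :: x' :: R).map Prod.fst) hx.isIdempotentElem (by simp)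
          (fun w hw => by
            obtain ⟨c, hc, rfl⟩ := List.mem_map.mp hw
            rw [hx.eq (hR c hc).2]
            exact (hR c hc).1)
        rwa [← MonoidHom.coe_fst, ← map_list_prod] at this
      · rcases hs.eq_or_lt hx.isIdempotentElem with h | h
        · exact .inl (h.symm ▸ hx)
        · exact .inr (by have := hx.le_mul; omega)
  have := exists_collapse_of_greedy (k := k + 2) hT hK
    (Good := fun R => ∀ c ∈ R, T k c.1 c.2 ∧ Stabilises p s c.2)
    (V := fun y => Stabilises p s y ∨ idealCard y ≤ d) (fun y hy => .inr hy) (by simp)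
    (fun R hR hR0 => by
      obtain ⟨y, hy, hyV⟩ := hcol R hR hR0
      exact ⟨y, hT.mono (by omega) hy, hyV⟩) hl ?_
  · obtain ⟨y, hy, hyV⟩ := this
    exact ⟨y, hT.mono (by omega) hy, hyV⟩
  intro x hx R hR
  obtain ⟨hxT, hxs | hxd⟩ := hval x hx
  · refine .inl fun c hc => ?_
    rcases List.mem_cons.mp hc with rfl | hc
    exacts [⟨hxT, hxs⟩, hR c hc]
  · right
    by_cases hR0 : R = []
    · exact ⟨x.2, by simpa [hR0] using hT.mono (by omega) hxT, hxd⟩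
    · obtain ⟨y, hy, -⟩ := hcol R hR hR0
      exact ⟨x.2 * y, by simpa using hT.mul (hT.mono (by omega) hxT) hy,
        (idealCard_mul_le_left _ _).trans hxd⟩

theorem idealCard_prod_le {d : ℕ} {l : List (W × M)} (hl : l ≠ [])
    (h : ∀ c ∈ l, idealCard c.2 ≤ d) : idealCard l.prod.2 ≤ d := by
  match l, hl with
  | x :: l, _ =>
    rw [List.prod_cons, Prod.snd_mul]
    exact (idealCard_mul_le_left _ _).trans (h x (by simp))

/-- Cutting a sequence behind each of its prefixes of type `(p, s)`. -/
theorem exists_chop {d C k : ℕ} {Θ : Set (M × M)} {p s b : M}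
    (hC : SmoothCollapses T d C Θ) (hd : d + 1 ≤ idealCard (p * s)) (l : List (W × M)) :
    l ≠ [] → (∀ c ∈ l, T k c.1 c.2 ∧ idealCard c.2 ≤ d + 1) → l.prod.2 * b = s →
    (∀ l₁ l₂, l = l₁ ++ l₂ → l₁ ≠ [] → l₂ ≠ [] →
      (p * l₁.prod.2, l₂.prod.2 * b) ∈ insert (p, s) Θ) →
    ∃ (mids : List (W × M)) (m : M) (w : W) (x y : M), l.prod.1 = mids.prod.1 * w ∧
      l.prod.2 = m * x ∧ (mids = [] ∧ m = 1 ∨ mids ≠ [] ∧ Stabilises p s m) ∧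
      (∀ c ∈ mids, T (k + C) c.1 c.2 ∧ (Stabilises p s c.2 ∨ idealCard c.2 ≤ d)) ∧
      T (k + C) w y ∧ (y = x ∨ idealCard y ≤ d) := by
  induction hn : l.length using Nat.strong_induction_on generalizing l with
  | _ n ih =>
  intro hl htok hb hcut
  by_cases hex : ∃ l₁ l₂, l = l₁ ++ l₂ ∧ l₁ ≠ [] ∧ l₂ ≠ [] ∧
      (p * l₁.prod.2, l₂.prod.2 * b) = (p, s)
  · obtain ⟨l₁, l₂, rfl, h1, h2, hP, hmin⟩ := exists_first_cut
      (P := fun l₁ l₂ : List (W × M) => (p * l₁.prod.2, l₂.prod.2 * b) = (p, s)) hex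
    obtain ⟨hp, hs⟩ := Prod.mk.inj hP
    have hstab : Stabilises p s l₁.prod.2 := by
      refine ⟨hp, ?_, (idealCard_prod_le h1 fun c hc => (htok c (by simp [hc])).2).trans hd⟩
      rw [← hs, ← mul_assoc, ← Prod.snd_mul, ← List.prod_append, hb]
      exact hs.symm
    obtain ⟨y₁, hy₁, hy₁'⟩ := hC k p s l₁ h1 (fun c hc => htok c (by simp [hc]))
      (by rwa [hp]) (fun m₁ m₂ hm hm1 hm2 => by
        have hmin' := hmin m₁ m₂ hm hm1 hm2
        have := hcut m₁ (m₂ ++ l₂) (by rw [hm, List.append_assoc]) hm1 (by simp [hm2])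
        rw [List.prod_append, Prod.snd_mul, mul_assoc, hs] at this hmin'
        exact this.resolve_left hmin')
    obtain ⟨mids, m, w, x, y, hw, hx, hm, hmids, hy, hy'⟩ := ih l₂.length
      (by rw [← hn, List.length_append]; have := List.length_pos_iff.mpr h1; omega) l₂ rfl h2
      (fun c hc => htok c (by simp [hc])) hs (fun m₁ m₂ hm hm1 hm2 => by
        have := hcut (l₁ ++ m₁) m₂ (by rw [hm, List.append_assoc]) (by simp [hm1]) hm2
        rwa [List.prod_append, Prod.snd_mul, ← mul_assoc, hp] at this)
    refine ⟨(l₁.prod.1, y₁) :: mids, l₁.prod.2 * m, w, x, y, ?_, ?_, .inr ⟨by simp, ?_⟩, ?_,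
      hy, hy'⟩
    · simp [hw, mul_assoc]
    · simp [hx, mul_assoc]
    · rcases hm with ⟨-, rfl⟩ | ⟨-, hm⟩
      · rwa [mul_one]
      -- Both factors are the unique stabiliser of `p` and `s`, which is idempotent.
      · rwa [hstab.eq hm, hm.isIdempotentElem.eq]
    · intro c hc
      rcases List.mem_cons.mp hc with rfl | hc
      · refine ⟨hy₁, hy₁'.imp_left ?_⟩
        rintro rfl
        exact hstab
      · exact hmids c hc
  · obtain ⟨y, hy, hy'⟩ := hC k p b l hl htok (by rwa [mul_assoc, hb]) (fun l₁ l₂ h h1 h2 =>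
      (hcut l₁ l₂ h h1 h2).resolve_left fun h' => hex ⟨l₁, l₂, h, h1, h2, h'⟩)
    exact ⟨[], 1, l.prod.1, l.prod.2, y, by simp, by simp, .inl ⟨rfl, rfl⟩, by simp, hy, hy'⟩

/-- Cutting at every occurrence of the type `τ = (p, s)` leaves pieces whose inner cuts lie in `Θ`.
The pieces strictly between two occurrences stabilise `p` and `s`, so they collapse together; the
first and last pieces are attached by products. -/
theorem SmoothCollapses.insert (hs : IsIteration sharp) (hT : CostedEval sharp T) {d C K : ℕ}
    (hK : Collapses T d K) {Θ : Set (M × M)} (hC : SmoothCollapses T d C Θ) (τ : M × M) :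
    SmoothCollapses T d (C + K + 5) (insert τ Θ) := by
  intro k a b l hl htok hd hcut
  by_cases hex : ∃ l₁ l₂, l = l₁ ++ l₂ ∧ l₁ ≠ [] ∧ l₂ ≠ [] ∧
      (a * l₁.prod.2, l₂.prod.2 * b) = τ
  swap
  · obtain ⟨y, hy, hy'⟩ := hC k a b l hl htok hd (fun l₁ l₂ h h1 h2 =>
      (hcut l₁ l₂ h h1 h2).resolve_left fun h' => hex ⟨l₁, l₂, h, h1, h2, h'⟩)
    exact ⟨y, hT.mono (by omega) hy, hy'⟩
  obtain ⟨l₁, l₂, rfl, h1, h2, rfl, hmin⟩ := exists_first_cut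
    (P := fun l₁ l₂ : List (W × M) => (a * l₁.prod.2, l₂.prod.2 * b) = τ) hex
  have htot : a * (l₁ ++ l₂).prod.2 * b = a * l₁.prod.2 * (l₂.prod.2 * b) := by
    simp [mul_assoc]
  rw [htot] at hd
  obtain ⟨y₁, hy₁, hy₁'⟩ := hC k a (l₂.prod.2 * b) l₁ h1 (fun c hc => htok c (by simp [hc])) hd
    (fun m₁ m₂ hm hm1 hm2 => by
      have hmin' := hmin m₁ m₂ hm hm1 hm2
      have := hcut m₁ (m₂ ++ l₂) (by rw [hm, List.append_assoc]) hm1 (by simp [hm2])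
      rw [List.prod_append, Prod.snd_mul, mul_assoc] at this hmin'
      exact this.resolve_left hmin')
  obtain ⟨mids, m, w, x, y, hw, hx, hm, hmids, hy, hy'⟩ := exists_chop (k := k) hC hd l₂ h2
    (fun c hc => htok c (by simp [hc])) rfl (fun m₁ m₂ hm hm1 hm2 => by
      have := hcut (l₁ ++ m₁) m₂ (by rw [hm, List.append_assoc]) (by simp [hm1]) hm2
      rwa [List.prod_append, Prod.snd_mul, ← mul_assoc] at this)
  have htail : ∃ z, T (k + C + K + 4) l₂.prod.1 z ∧ (z = l₂.prod.2 ∨ idealCard z ≤ d) := by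
    rw [hw, hx]
    rcases hm with ⟨rfl, rfl⟩ | ⟨hne, hm⟩
    · exact ⟨y, by simpa using hT.mono (by omega) hy, by simpa using hy'⟩
    have hle : idealCard (a * l₁.prod.2 * (l₂.prod.2 * b)) ≤ d + 1 := by
      rw [mul_assoc, ← mul_assoc]
      refine (idealCard_mul_le_left _ _).trans ((idealCard_mul_le_right _ _).trans ?_)
      exact idealCard_prod_le h1 fun c hc => (htok c (by simp [hc])).2
    obtain ⟨z, hz, hz'⟩ := exists_collapse_of_stabilises hs hT hK hle hne hmids
    refine ⟨z * y, hT.mul hz (hT.mono (by omega) hy), ?_⟩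
    rcases hz' with hz' | hz'
    · rcases hy' with rfl | hy'
      · exact .inl (by rw [hz'.eq hm])
      · exact .inr ((idealCard_mul_le_right _ _).trans hy')
    · exact .inr ((idealCard_mul_le_left _ _).trans hz')
  obtain ⟨z, hz, hz'⟩ := htail
  refine ⟨y₁ * z, ?_, ?_⟩
  · rw [List.prod_append, Prod.fst_mul]
    exact hT.mono (by omega) (hT.mul (hT.mono (by omega) hy₁) hz)
  · rcases hy₁' with rfl | hy₁'
    · rcases hz' with rfl | hz'
      · exact .inl (by simp)
      · exact .inr ((idealCard_mul_le_right _ _).trans hz')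
    · exact .inr ((idealCard_mul_le_left _ _).trans hy₁')

theorem exists_smoothCollapses (hs : IsIteration sharp) (hT : CostedEval sharp T) {d K : ℕ}
    (hK : Collapses T d K) : ∃ C, SmoothCollapses T d C Set.univ := by
  refine Set.Finite.induction_on (motive := fun Θ _ => ∃ C, SmoothCollapses T d C Θ) _
    Set.finite_univ ⟨0, smoothCollapses_empty T d⟩ ?_
  rintro τ Θ - - ⟨C, hC⟩
  exact ⟨_, hC.insert hs hT hK τ⟩

/-- Induction on `d`: runs whose product stays at level `d + 1` are smooth and collapse at a fixed
cost. The letter that makes the product drop closes a block of level `d`, to which the induction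
hypothesis applies. -/
theorem exists_collapses (hs : IsIteration sharp) (hT : CostedEval sharp T) (d : ℕ) :
    ∃ K, Collapses T d K := by
  induction d with
  | zero =>
    -- Vacuous: ideal cardinalities are positive.
    refine ⟨0, fun k l hl h => ?_⟩
    obtain ⟨x, hx⟩ := List.exists_mem_of_ne_nil l hl
    have := (h x hx).2
    have := idealCard_pos x.2
    omega
  | succ d ih =>
    obtain ⟨K, hK⟩ := ih
    obtain ⟨C, hC⟩ := exists_smoothCollapses hs hT hK
    refine ⟨C + K + 2, fun k l hl htok => ?_⟩
    have hcol : ∀ R : List (W × M), (∀ c ∈ R, T k c.1 c.2 ∧ idealCard c.2 ≤ d + 1) →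
        d + 1 ≤ idealCard R.prod.2 → R ≠ [] →
        ∃ y, T (k + C) R.prod.1 y ∧ (y = R.prod.2 ∨ idealCard y ≤ d) := fun R hR hRd hR0 =>
      hC k 1 1 R hR0 hR (by simpa using hRd) (by simp)
    have := exists_collapse_of_greedy (k := k + C + 1) hT hK
      (Good := fun R => (∀ c ∈ R, T k c.1 c.2 ∧ idealCard c.2 ≤ d + 1) ∧
        (R ≠ [] → d + 1 ≤ idealCard R.prod.2))
      (V := fun y => idealCard y ≤ d + 1) (fun y hy => by omega) (by simp)
      (fun R hR hR0 => by
        obtain ⟨y, hy, hy'⟩ := hcol R hR.1 (hR.2 hR0) hR0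
        refine ⟨y, hT.mono (by omega) hy, ?_⟩
        rcases hy' with rfl | hy'
        · exact idealCard_prod_le hR0 fun c hc => (hR.1 c hc).2
        · omega) hl ?_
    · obtain ⟨y, hy, hy'⟩ := this
      exact ⟨y, hT.mono (by omega) hy, hy'⟩
    rintro x hx R ⟨hR, hRd⟩
    by_cases hgood : d + 1 ≤ idealCard (x :: R).prod.2
    · refine .inl ⟨fun c hc => ?_, fun _ => hgood⟩
      rcases List.mem_cons.mp hc with rfl | hc
      exacts [htok c hx, hR c hc]
    right
    by_cases hR0 : R = []
    · subst hR0
      exact ⟨x.2, by simpa using hT.mono (by omega) (htok x hx).1, by simpa using hgood⟩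
    obtain ⟨y, hy, hy'⟩ := hcol R hR (hRd hR0) hR0
    refine ⟨x.2 * y, by simpa using hT.mul (hT.mono (by omega) (htok x hx).1) hy, ?_⟩
    rcases hy' with rfl | hy'
    · rw [List.prod_cons, Prod.snd_mul] at hgood
      omega
    · exact (idealCard_mul_le_right _ _).trans hy'

/-- All sequences of words of cost `0` evaluate at a bounded cost. -/
theorem exists_uniform_cost (hs : IsIteration sharp) (hT : CostedEval sharp T) :
    ∃ K, ∀ l : List (W × M), l ≠ [] → (∀ c ∈ l, T 0 c.1 c.2) → ∃ y, T K l.prod.1 y := by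
  obtain ⟨K, hK⟩ := exists_collapses hs hT (Nat.card M)
  refine ⟨K, fun l hl h => ?_⟩
  obtain ⟨y, hy, -⟩ := hK 0 l hl fun c hc =>
    ⟨h c hc, (Set.ncard_le_ncard (Set.subset_univ _)).trans (Set.ncard_univ M).le⟩
  exact ⟨y, by simpa using hy⟩

end Collapse
end FactorizationForest

open Matrix Filter Topology

/-! ### Supports of nonnegative and stochastic matrices. -/

section Supports

variable {Q : Type*}

/-- The limit-word `u` describes the positive entries of the matrix `P`. -/
def Matrix.HasSupport (P : Matrix Q Q ℝ) (u : LimitWord Q) : Prop :=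
  ∀ s t, 0 < P s t ↔ u.edge s t

theorem Matrix.HasSupport.unique {P : Matrix Q Q ℝ} {u v : LimitWord Q} (hu : P.HasSupport u)
    (hv : P.HasSupport v) : u = v := by
  ext s t
  rw [← hu s t, hv s t]

theorem Matrix.hasSupport_one [DecidableEq Q] : (1 : Matrix Q Q ℝ).HasSupport 1 := fun s t => by
  rw [LimitWord.one_edge, Matrix.one_apply]
  split_ifs with h <;> simp [h]

theorem exists_pos_le_of_finite {ι : Type*} [Finite ι] (f : ι → ℝ) :
    ∃ c, 0 < c ∧ c ≤ 1 ∧ ∀ i, 0 < f i → c ≤ f i := by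
  have := Fintype.ofFinite ι
  obtain ⟨c, hc, h⟩ : ∃ c, 0 < c ∧ ∀ i, c ≤ if 0 < f i then f i else 1 := by
    rcases isEmpty_or_nonempty ι with hι | hι
    · exact ⟨1, one_pos, fun i => hι.elim i⟩
    · obtain ⟨i, hi⟩ := Finite.exists_min fun i => if 0 < f i then f i else (1 : ℝ)
      refine ⟨_, ?_, hi⟩
      split_ifs with h
      exacts [h, one_pos]
  refine ⟨min c 1, by positivity, min_le_right _ _, fun i hi => (min_le_left _ _).trans ?_⟩
  simpa [hi] using h i

variable [Fintype Q]

theorem Matrix.mul_apply_pos_iff {P R : Matrix Q Q ℝ} (hP : ∀ s t, 0 ≤ P s t)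
    (hR : ∀ s t, 0 ≤ R s t) (s t : Q) : 0 < (P * R) s t ↔ ∃ q, 0 < P s q ∧ 0 < R q t := by
  rw [Matrix.mul_apply, Finset.sum_pos_iff_of_nonneg fun q _ => mul_nonneg (hP s q) (hR q t)]
  refine ⟨fun ⟨q, _, h⟩ => ⟨q, ?_⟩, fun ⟨q, h1, h2⟩ => ⟨q, Finset.mem_univ q, mul_pos h1 h2⟩⟩
  exact ⟨(hP s q).lt_of_ne' (left_ne_zero_of_mul h.ne'),
    (hR q t).lt_of_ne' (right_ne_zero_of_mul h.ne')⟩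

variable [DecidableEq Q]

theorem Matrix.HasSupport.mul {P R : Matrix Q Q ℝ} {u v : LimitWord Q}
    (hP : P ∈ rowStochastic ℝ Q) (hR : R ∈ rowStochastic ℝ Q) (hu : P.HasSupport u)
    (hv : R.HasSupport v) : (P * R).HasSupport (u * v) := fun s t => by
  rw [mul_apply_pos_iff (fun _ _ => nonneg_of_mem_rowStochastic hP)
    fun _ _ => nonneg_of_mem_rowStochastic hR, LimitWord.mul_edge]
  simp only [hu s, hv _ t]

theorem Matrix.HasSupport.pow {P : Matrix Q Q ℝ} {u : LimitWord Q}
    (hP : P ∈ rowStochastic ℝ Q) (hu : P.HasSupport u) (n : ℕ) :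
    (P ^ n).HasSupport (u ^ n) := by
  induction n with
  | zero => simpa using hasSupport_one
  | succ n ih => simpa only [pow_succ] using ih.mul (pow_mem hP n) hP hu

/-- If every state reached from `t` by `R` has a transition by `B` to `t` of probability at
least `c`, then so has `t` itself by `R * B`. -/
theorem Matrix.le_mul_mul_apply {P R B : Matrix Q Q ℝ} (hP : P ∈ rowStochastic ℝ Q)
    (hR : R ∈ rowStochastic ℝ Q) (hB : B ∈ rowStochastic ℝ Q) {s t : Q} {c : ℝ} (hc : 0 ≤ c)
    (h1 : c ≤ P s t) (h2 : ∀ q, 0 < R t q → c ≤ B q t) : c * c ≤ (P * (R * B)) s t := by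
  have hRB : c ≤ (R * B) t t := by
    rw [Matrix.mul_apply, ← one_mul c, ← sum_row_of_mem_rowStochastic hR t, Finset.sum_mul]
    refine Finset.sum_le_sum fun q _ => ?_
    rcases (nonneg_of_mem_rowStochastic hR (i := t) (j := q)).eq_or_lt with h | h
    · simp [← h]
    · exact mul_le_mul_of_nonneg_left (h2 q h) h.le
  rw [Matrix.mul_apply]
  calc c * c ≤ P s t * (R * B) t t := mul_le_mul h1 hRB hc (hc.trans h1)
    _ ≤ _ := Finset.single_le_sum (f := fun q => P s q * (R * B) q t)
      (fun q _ => mul_nonneg (nonneg_of_mem_rowStochastic hP)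
        (nonneg_of_mem_rowStochastic (mul_mem hR hB))) (Finset.mem_univ t)

end Supports

/-! ### Algebra of limit-words and their iteration. -/

namespace LimitWord

variable {Q : Type*}

theorem Recurrent.of_edge {u : LimitWord Q} (hu : IsIdempotentElem u) {s t : Q}
    (hs : u.Recurrent s) (h : u.edge s t) : u.Recurrent t := fun x hx =>
  edge_trans hu (hs x (edge_trans hu h hx)) h

theorem Recurrent.edge_self {u : LimitWord Q} (hu : IsIdempotentElem u) {s : Q}
    (hs : u.Recurrent s) : u.edge s s := by
  obtain ⟨t, ht⟩ := u.exists_edge s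
  exact edge_trans hu ht (hs t ht)

theorem pow_edge {u : LimitWord Q} (hu : IsIdempotentElem u) {n : ℕ} {s t : Q}
    (h : (u ^ n).edge s t) : s = t ∨ u.edge s t := by
  rcases n with - | n
  · exact .inl h
  · rw [hu.pow_succ_eq] at h
    exact .inr h

theorem isIdempotentElem_prod {p : LimitWord Q × LimitWord Q} (h : IsIdempotentElem p) :
    IsIdempotentElem p.1 ∧ IsIdempotentElem p.2 :=
  ⟨congrArg Prod.fst h, congrArg Prod.snd h⟩

instance [Finite Q] : Finite (LimitWord Q) :=
  Finite.of_injective LimitWord.edge fun _ _ h => LimitWord.ext h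

variable [Finite Q]

theorem isIdempotentElem_iterate {u : LimitWord Q} (hu : IsIdempotentElem u) :
    IsIdempotentElem (u.iterate hu) := by
  ext s t
  refine ⟨fun ⟨q, h1, h2⟩ => ⟨edge_trans hu h1.1 h2.1, h2.2⟩, fun h => ⟨t, h, ?_, h.2⟩⟩
  exact h.2.edge_self hu

theorem mul_iterate {u : LimitWord Q} (hu : IsIdempotentElem u) :
    u * u.iterate hu = u.iterate hu := by
  ext s t
  refine ⟨fun ⟨q, h1, h2⟩ => ⟨edge_trans hu h1 h2.1, h2.2⟩, fun h => ⟨t, h.1, ?_, h.2⟩⟩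
  exact h.2.edge_self hu

theorem iterate_mul {u : LimitWord Q} (hu : IsIdempotentElem u) :
    u.iterate hu * u = u.iterate hu := by
  ext s t
  refine ⟨fun ⟨q, h1, h2⟩ => ⟨edge_trans hu h1.1 h2, h1.2.of_edge hu h2⟩,
    fun h => ⟨t, h, h.2.edge_self hu⟩⟩

open Classical in
/-- The iteration of extended limit-words. -/
noncomputable def extendedIterate (p : LimitWord Q × LimitWord Q) : LimitWord Q × LimitWord Q :=
  -- The default `p` is harmless: `IsIteration` and `CostedEval` only concern idempotents.
  if h : IsIdempotentElem p.1 then (p.1.iterate h, p.2) else p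

theorem extendedIterate_of_isIdempotentElem {p : LimitWord Q × LimitWord Q}
    (h : IsIdempotentElem p) :
    extendedIterate p = (p.1.iterate (isIdempotentElem_prod h).1, p.2) :=
  dif_pos (isIdempotentElem_prod h).1

theorem isIteration_extendedIterate :
    FactorizationForest.IsIteration (extendedIterate (Q := Q)) where
  idem h := by
    rw [extendedIterate_of_isIdempotentElem h]
    exact Prod.ext (isIdempotentElem_iterate (isIdempotentElem_prod h).1) (isIdempotentElem_prod h).2
  mul_left h := by
    rw [extendedIterate_of_isIdempotentElem h]
    exact Prod.ext (mul_iterate (isIdempotentElem_prod h).1) (isIdempotentElem_prod h).2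
  mul_right h := by
    rw [extendedIterate_of_isIdempotentElem h]
    exact Prod.ext (iterate_mul (isIdempotentElem_prod h).1) (isIdempotentElem_prod h).2

end LimitWord

/-! ### Compactness and limits of powers of stochastic matrices. -/

section Limits

variable {Q : Type*} [Fintype Q] [DecidableEq Q]

theorem isClosed_rowStochastic : IsClosed (rowStochastic ℝ Q : Set (Matrix Q Q ℝ)) := by
  have : (rowStochastic ℝ Q : Set (Matrix Q Q ℝ)) =
      (⋂ s, ⋂ t, {P | 0 ≤ P s t}) ∩ ⋂ s, {P | ∑ t, P s t = 1} := by
    ext P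
    simp [mem_rowStochastic_iff_sum]
  rw [this]
  refine .inter (isClosed_iInter fun s => isClosed_iInter fun t => ?_) (isClosed_iInter fun s => ?_)
  · exact isClosed_le continuous_const (by fun_prop)
  · exact isClosed_eq (by fun_prop) continuous_const

theorem isCompact_rowStochastic : IsCompact (rowStochastic ℝ Q : Set (Matrix Q Q ℝ)) := by
  refine IsCompact.of_isClosed_subset (s := Set.univ.pi fun _ => Set.univ.pi fun _ => Set.Icc 0 1)
    ?_ isClosed_rowStochastic ?_
  · exact isCompact_univ_pi fun s => isCompact_univ_pi fun t => isCompact_Icc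
  · intro P hP s _ t _
    exact ⟨nonneg_of_mem_rowStochastic hP, le_one_of_mem_rowStochastic hP⟩

/-- The mass of the transient states decreases exponentially. -/
theorem sum_transient_le {P : Matrix Q Q ℝ} (hP : P ∈ rowStochastic ℝ Q) {u : LimitWord Q}
    (hu : IsIdempotentElem u) (hsupp : P.HasSupport u) {c : ℝ} (hc1 : c ≤ 1)
    (hc : ∀ s t, u.edge s t → c ≤ P s t) {S : Finset Q} (hS : ∀ t, t ∈ S ↔ ¬ u.Recurrent t)
    (s : Q) (n : ℕ) : ∑ t ∈ S, (P ^ n) s t ≤ (1 - c) ^ n := by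
  induction n with
  | zero =>
    rw [pow_zero, pow_zero, ← sum_row_of_mem_rowStochastic (one_mem (rowStochastic ℝ Q)) s]
    exact Finset.sum_le_sum_of_subset_of_nonneg (Finset.subset_univ _) fun _ _ _ =>
      nonneg_of_mem_rowStochastic (one_mem _)
  | succ n ih =>
    have hPn := pow_mem hP n
    have hstep : ∀ q, ∑ t ∈ S, P q t ≤ if q ∈ S then 1 - c else 0 := by
      intro q
      split_ifs with hq
      -- A transient state sends mass at least `c` to some recurrent state; a recurrent state sends
      -- none back.
      · obtain ⟨x, hx, hxr⟩ := LimitWord.exists_edge_recurrent hu q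
        have hxS : x ∉ S := fun h => (hS x).mp h hxr
        have := Finset.sum_le_sum_of_subset_of_nonneg (Finset.subset_univ (insert x S))
          fun t _ _ => nonneg_of_mem_rowStochastic hP (i := q) (j := t)
        rw [Finset.sum_insert hxS, sum_row_of_mem_rowStochastic hP] at this
        linarith [hc q x hx]
      · have hqr : u.Recurrent q := by simpa [hS] using hq
        refine Finset.sum_nonpos fun t ht => not_lt.mp fun h => (hS t).mp ht ?_
        exact hqr.of_edge hu ((hsupp q t).mp h)
    calc ∑ t ∈ S, (P ^ (n + 1)) s t = ∑ q, (P ^ n) s q * ∑ t ∈ S, P q t := by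
          simp only [pow_succ, Matrix.mul_apply, Finset.mul_sum]
          exact Finset.sum_comm
      _ ≤ ∑ q, (P ^ n) s q * if q ∈ S then 1 - c else 0 :=
          Finset.sum_le_sum fun q _ => mul_le_mul_of_nonneg_left (hstep q)
            (nonneg_of_mem_rowStochastic hPn)
      _ = (∑ q ∈ S, (P ^ n) s q) * (1 - c) := by
          simp [Finset.sum_mul, Finset.sum_ite_mem]
      _ ≤ (1 - c) ^ n * (1 - c) := mul_le_mul_of_nonneg_right ih (by linarith)
      _ = _ := (pow_succ _ _).symm

/-- The powers of a stochastic matrix with idempotent support have a limit point whose support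
is the iteration. -/
theorem exists_tendsto_pow_hasSupport_iterate {P : Matrix Q Q ℝ} (hP : P ∈ rowStochastic ℝ Q)
    {u : LimitWord Q} (hu : IsIdempotentElem u) (hsupp : P.HasSupport u) :
    ∃ (R : Matrix Q Q ℝ) (φ : ℕ → ℕ), (∀ n, 0 < φ n) ∧ R.HasSupport (u.iterate hu) ∧
      Tendsto (fun n => P ^ φ n) atTop (𝓝 R) := by
  classical
  have : FirstCountableTopology (Matrix Q Q ℝ) :=
    inferInstanceAs (FirstCountableTopology (Q → Q → ℝ))
  obtain ⟨c, hc0, hc1, hc⟩ := exists_pos_le_of_finite fun x : Q × Q => P x.1 x.2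
  have hcu : ∀ s t, u.edge s t → c ≤ P s t := fun s t h => hc (s, t) ((hsupp s t).mpr h)
  -- The shift by 2 reserves a first step into the recurrent state `t` and a last step back to it,
  -- which gives the lower bound `c * c`.
  obtain ⟨R, -, φ, hφ, hR⟩ := isCompact_rowStochastic.tendsto_subseq
    (x := fun n => P ^ (n + 2)) fun n => pow_mem hP _
  have hRst : ∀ s t, Tendsto (fun n => (P ^ (φ n + 2)) s t) atTop (𝓝 (R s t)) := fun s t =>
    (tendsto_pi_nhds.mp (tendsto_pi_nhds.mp hR s)) t
  refine ⟨R, fun n => φ n + 2, fun n => by positivity, fun s t => ⟨fun h => ?_, fun h => ?_⟩, hR⟩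
  · obtain ⟨n, hn⟩ := ((hRst s t).eventually_const_lt h).exists
    have hst := ((hsupp.pow hP _) s t).mp hn
    rw [hu.pow_succ_eq] at hst
    refine ⟨hst, ?_⟩
    by_contra htr
    have hle : ∀ n, (P ^ (φ n + 2)) s t ≤ (1 - c) ^ (φ n + 2) := fun n => by
      refine le_trans ?_ (sum_transient_le (S := {t | ¬ u.Recurrent t}) hP hu hsupp hc1 hcu
        (by simp) s (φ n + 2))
      exact Finset.single_le_sum (f := fun t => (P ^ (φ n + 2)) s t)
        (fun t _ => nonneg_of_mem_rowStochastic (pow_mem hP _)) (by simpa using htr)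
    have hlim : Tendsto (fun n => (1 - c) ^ (φ n + 2)) atTop (𝓝 0) :=
      (tendsto_pow_atTop_nhds_zero_of_lt_one (by linarith) (by linarith)).comp
        (tendsto_atTop_mono (fun n => (hφ.id_le n).trans (by simp)) tendsto_id)
    exact h.not_ge (le_of_tendsto_of_tendsto' (hRst s t) hlim hle)
  · refine (mul_pos hc0 hc0).trans_le (ge_of_tendsto' (hRst s t) fun n => ?_)
    rw [pow_succ', pow_succ]
    refine Matrix.le_mul_mul_apply hP (pow_mem hP _) hP hc0.le (hcu s t h.1) fun q hq => ?_
    rcases LimitWord.pow_edge hu (((hsupp.pow hP _) t q).mp hq) with rfl | hq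
    · exact hcu _ _ (h.2.edge_self hu)
    · exact hcu _ _ (h.2 q hq)

end Limits


/-! ### Reachability in a chain compared with edges of a limit-word. -/

section Chain

variable {Q : Type*} [Fintype Q] [DecidableEq Q] {P : Matrix Q Q ℝ}

theorem ChainReachable.refl (P : Matrix Q Q ℝ) (s : Q) : ChainReachable P s s := ⟨0, by simp⟩

theorem ChainReachable.of_pos {s t : Q} (h : 0 < P s t) : ChainReachable P s t :=
  ⟨1, by simpa using h⟩

theorem ChainReachable.trans (hP : P ∈ rowStochastic ℝ Q) {s t q : Q}
    (h1 : ChainReachable P s t) (h2 : ChainReachable P t q) : ChainReachable P s q := by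
  obtain ⟨k, hk⟩ := h1
  obtain ⟨l, hl⟩ := h2
  refine ⟨k + l, ?_⟩
  rw [pow_add, mul_apply_pos_iff (fun _ _ => nonneg_of_mem_rowStochastic (pow_mem hP k))
    fun _ _ => nonneg_of_mem_rowStochastic (pow_mem hP l)]
  exact ⟨t, hk, hl⟩

/-- Edges of an idempotent limit-word compose, so a path shrinks to one edge. The equality covers
the empty path, as `u` need not be reflexive. -/
theorem ChainReachable.eq_or_edge (hP : P ∈ rowStochastic ℝ Q) {u : LimitWord Q}
    (hu : IsIdempotentElem u) (h : ∀ s t, 0 < P s t → u.edge s t) {s t : Q}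
    (hst : ChainReachable P s t) : s = t ∨ u.edge s t := by
  obtain ⟨k, hk⟩ := hst
  induction k generalizing t with
  | zero =>
    refine .inl ?_
    by_contra hne
    simp [Matrix.one_apply_ne hne] at hk
  | succ k ih =>
    rw [pow_succ, mul_apply_pos_iff (fun _ _ => nonneg_of_mem_rowStochastic (pow_mem hP k))
      fun _ _ => nonneg_of_mem_rowStochastic hP] at hk
    obtain ⟨q, h1, h2⟩ := hk
    rcases ih h1 with rfl | hq
    · exact .inr (h _ _ h2)
    · exact .inr (LimitWord.edge_trans hu hq (h _ _ h2))

theorem LimitWord.chainReachable_of_pow_edge (hP : P ∈ rowStochastic ℝ Q) {u : LimitWord Q}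
    (h : ∀ s t, u.edge s t → 0 < P s t) {n : ℕ} {s t : Q} (hst : (u ^ n).edge s t) :
    ChainReachable P s t := by
  induction n generalizing t with
  | zero =>
    obtain rfl : s = t := hst
    exact .refl P s
  | succ n ih =>
    rw [pow_succ] at hst
    obtain ⟨q, h1, h2⟩ := hst
    exact (ih h1).trans hP (.of_pos (h _ _ h2))

end Chain

/-! ### Leak witnesses and leaks. -/

namespace ProbAutomaton

variable {Q A : Type*} [Fintype Q] [DecidableEq Q] (𝒜 : ProbAutomaton Q A)

theorem wordMatrix_append (w w' : List A) :
    𝒜.wordMatrix (w ++ w') = 𝒜.wordMatrix w * 𝒜.wordMatrix w' := by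
  simp [wordMatrix]

theorem wordMatrix_mem (w : List A) : 𝒜.wordMatrix w ∈ rowStochastic ℝ Q :=
  list_prod_mem fun P hP => by
    obtain ⟨a, -, rfl⟩ := List.mem_map.mp hP
    exact 𝒜.trans_stochastic a

theorem hasSupport_letter (a : A) : (𝒜.trans a).HasSupport (𝒜.letter a) := fun _ _ => Iff.rfl

theorem isIdempotentWord_iff {w : List A} {v : LimitWord Q} (h : (𝒜.wordMatrix w).HasSupport v) :
    𝒜.IsIdempotentWord w ↔ IsIdempotentElem v := by
  have h2 : (𝒜.wordMatrix (w ++ w)).HasSupport (v * v) := by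
    rw [wordMatrix_append]
    exact h.mul (𝒜.wordMatrix_mem w) (𝒜.wordMatrix_mem w) h
  constructor
  · intro hw
    ext s t
    rw [← h2 s t, ← hw s t, h s t]
  · intro hv s t
    rw [h s t, h2 s t, hv.eq]

/-- The matrices of the words with support `v`. -/
def matricesWithSupport (v : LimitWord Q) : Set (Matrix Q Q ℝ) :=
  {P | P.HasSupport v ∧ ∃ w, 𝒜.wordMatrix w = P}

variable {𝒜}

theorem closure_matricesWithSupport_subset (v : LimitWord Q) :
    closure (𝒜.matricesWithSupport v) ⊆ rowStochastic ℝ Q := by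
  refine closure_minimal ?_ isClosed_rowStochastic
  rintro _ ⟨-, w, rfl⟩
  exact 𝒜.wordMatrix_mem w

theorem mul_mem_matricesWithSupport {P R : Matrix Q Q ℝ} {v v' : LimitWord Q}
    (hP : P ∈ 𝒜.matricesWithSupport v) (hR : R ∈ 𝒜.matricesWithSupport v') :
    P * R ∈ 𝒜.matricesWithSupport (v * v') := by
  obtain ⟨hv, w, rfl⟩ := hP
  obtain ⟨hv', w', rfl⟩ := hR
  exact ⟨hv.mul (𝒜.wordMatrix_mem w) (𝒜.wordMatrix_mem w') hv', w ++ w',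
    𝒜.wordMatrix_append w w'⟩

theorem mul_mem_closure_matricesWithSupport {P R : Matrix Q Q ℝ} {v v' : LimitWord Q}
    (hP : P ∈ closure (𝒜.matricesWithSupport v)) (hR : R ∈ closure (𝒜.matricesWithSupport v')) :
    P * R ∈ closure (𝒜.matricesWithSupport (v * v')) :=
  map_mem_closure₂ (f := fun P R => P * R) (by fun_prop) hP hR fun _ h _ h' =>
    mul_mem_matricesWithSupport h h'

/-- Every element of the extended Markov monoid is realised by a limit of words. -/
theorem MemExtended.exists_mem_closure {p : LimitWord Q × LimitWord Q} (hp : 𝒜.MemExtended p) :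
    ∃ P ∈ closure (𝒜.matricesWithSupport p.2), P.HasSupport p.1 := by
  induction hp with
  | letter a =>
    exact ⟨𝒜.trans a, subset_closure ⟨𝒜.hasSupport_letter a, [a], by simp [wordMatrix]⟩,
      𝒜.hasSupport_letter a⟩
  | one => exact ⟨1, subset_closure ⟨hasSupport_one, [], by simp [wordMatrix]⟩, hasSupport_one⟩
  | mul _ _ ih ih' =>
    obtain ⟨P, hP, hu⟩ := ih
    obtain ⟨R, hR, hu'⟩ := ih'
    exact ⟨P * R, mul_mem_closure_matricesWithSupport hP hR,
      hu.mul (closure_matricesWithSupport_subset _ hP) (closure_matricesWithSupport_subset _ hR)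
        hu'⟩
  | @iterate u v hu hv _ ih =>
    obtain ⟨P, hP, hPu⟩ := ih
    obtain ⟨R, φ, hφ, hR, hlim⟩ := exists_tendsto_pow_hasSupport_iterate
      (closure_matricesWithSupport_subset _ hP) hu hPu
    refine ⟨R, isClosed_closure.mem_of_tendsto hlim (.of_forall fun n => ?_), hR⟩
    -- Positive powers stay in the closure since `v * v = v`; the zeroth power need not.
    obtain ⟨m, hm⟩ := Nat.exists_eq_succ_of_ne_zero (hφ n).ne'
    rw [hm]
    clear hm
    induction m with
    | zero => simpa using hP
    | succ m ih =>
      have := mul_mem_closure_matricesWithSupport ih hP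
      rwa [hv.eq, ← pow_succ] at this

theorem not_leaktight_of_isLeakWitness {p : LimitWord Q × LimitWord Q} (hp : 𝒜.MemExtended p)
    (hw : LimitWord.IsLeakWitness p) : ¬ 𝒜.Leaktight := by
  obtain ⟨hidem, r, q, hr, hrq, hqr⟩ := hw
  obtain ⟨hu, hv⟩ := LimitWord.isIdempotentElem_prod hidem
  obtain ⟨P, hP, hPu⟩ := hp.exists_mem_closure
  have : FrechetUrysohnSpace (Matrix Q Q ℝ) :=
    inferInstanceAs (FrechetUrysohnSpace (Q → Q → ℝ))
  have hPs := closure_matricesWithSupport_subset _ hP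
  obtain ⟨x, hx, hlim⟩ := mem_closure_iff_seq_limit.mp hP
  choose hxv w hwx using hx
  have hreach : ∀ s t, ChainReachable P s t → s = t ∨ p.1.edge s t := fun s t =>
    ChainReachable.eq_or_edge hPs hu fun s t => (hPu s t).mp
  refine not_not.mpr ⟨w, r, q, fun n => ?_, P, fun s t => ?_, fun t ht => ?_, fun n => ?_, ?_⟩
  · rw [𝒜.isIdempotentWord_iff (hwx n ▸ hxv n)]
    exact hv
  · simp only [hwx]
    exact tendsto_pi_nhds.mp (tendsto_pi_nhds.mp hlim s) t
  · rcases hreach r t ht with rfl | h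
    · exact ht
    · exact .of_pos ((hPu t r).mpr (hr t h))
  · rw [hwx, hxv n]
    exact hrq
  · intro h
    rcases hreach q r h with rfl | h
    · exact hqr (hr.edge_self hu)
    · exact hqr h

/-- `P` is a stochastic matrix with support `p.2`, and its transitions along `p.1` have
probability at least `c ^ 2 ^ k`. -/
structure BoundedBelow (𝒜 : ProbAutomaton Q A) (c : ℝ) (k : ℕ) (P : Matrix Q Q ℝ)
    (p : LimitWord Q × LimitWord Q) : Prop where
  mem : 𝒜.MemExtended p
  stochastic : P ∈ rowStochastic ℝ Q
  hasSupport : P.HasSupport p.2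
  le : ∀ s t, p.1.edge s t → c ^ 2 ^ k ≤ P s t

/-- For an iteration at a `u`-recurrent state `t`, the first word goes to `t`, the middle words lead
from `t` only to `t` itself or to some `q` with a `v`-edge from `t`, and the last word returns to
`t`. The return is bounded below because a missing `u`-edge from `q` to `t` would make the pair a
leak witness. -/
theorem costedEval_boundedBelow (hno : ¬ ∃ p ∈ 𝒜.extendedMarkovMonoid, LimitWord.IsLeakWitness p)
    {c : ℝ} (hc0 : 0 < c) (hc1 : c ≤ 1) :
    FactorizationForest.CostedEval LimitWord.extendedIterate (𝒜.BoundedBelow c) where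
  mono {k l w x} hkl h := ⟨h.mem, h.stochastic, h.hasSupport, fun s t hst =>
    (pow_le_pow_of_le_one hc0.le hc1 (Nat.pow_le_pow_right two_pos hkl)).trans (h.le s t hst)⟩
  mul {k w w' x x'} h h' := by
    refine ⟨h.mem.mul h'.mem, mul_mem h.stochastic h'.stochastic,
      h.hasSupport.mul h.stochastic h'.stochastic h'.hasSupport, fun s t hst => ?_⟩
    obtain ⟨q, h1, h2⟩ := hst
    rw [pow_succ, mul_two, pow_add, Matrix.mul_apply]
    refine (mul_le_mul (h.le s q h1) (h'.le q t h2) (by positivity)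
      (nonneg_of_mem_rowStochastic h.stochastic)).trans ?_
    exact Finset.single_le_sum (f := fun q => w s q * w' q t)
      (fun q _ => mul_nonneg (nonneg_of_mem_rowStochastic h.stochastic)
        (nonneg_of_mem_rowStochastic h'.stochastic)) (Finset.mem_univ q)
  iterate {k e l} he hlen hl := by
    obtain ⟨hu, hv⟩ := LimitWord.isIdempotentElem_prod he
    rw [LimitWord.extendedIterate_of_isIdempotentElem he]
    have hmem : ∀ m : List (Matrix Q Q ℝ), (∀ P ∈ m, 𝒜.BoundedBelow c k P e) →
        m.prod ∈ rowStochastic ℝ Q ∧ m.prod.HasSupport (e.2 ^ m.length) := by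
      intro m hm
      induction m with
      | nil => exact ⟨one_mem _, hasSupport_one⟩
      | cons P m ih =>
        have hP := hm P (by simp)
        obtain ⟨h1, h2⟩ := ih fun P hP => hm P (List.mem_cons_of_mem _ hP)
        rw [List.prod_cons, List.length_cons, pow_succ']
        exact ⟨mul_mem hP.stochastic h1, hP.hasSupport.mul hP.stochastic h1 h2⟩
    obtain ⟨P, m, B, rfl⟩ : ∃ P m B, l = P :: (m ++ [B]) := by
      match l, hlen with
      | P :: x :: l, _ =>
        exact ⟨P, (x :: l).dropLast, (x :: l).getLast (by simp),
          by rw [List.dropLast_append_getLast]⟩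
    have hP := hl P (by simp)
    have hB := hl B (by simp)
    obtain ⟨hm, hmv⟩ := hmem m fun P hP => hl P (by simp [hP])
    obtain ⟨hprod, hsupp⟩ := hmem _ hl
    refine ⟨.iterate hu hv hP.mem, hprod, ?_, fun s t hst => ?_⟩
    · rwa [List.length_cons, hv.pow_succ_eq] at hsupp
    obtain ⟨hst, htr⟩ : e.1.edge s t ∧ e.1.Recurrent t := hst
    rw [pow_succ, mul_two, pow_add, List.prod_cons, List.prod_append, List.prod_singleton]
    refine le_mul_mul_apply hP.stochastic hm hB.stochastic (by positivity) (hP.le s t hst)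
      fun q hq => hB.le q t ?_
    rcases LimitWord.pow_edge hv ((hmv t q).mp hq) with rfl | hq
    · exact htr.edge_self hu
    · by_contra hqt
      exact hno ⟨e, hP.mem, he, t, q, htr, hq, hqt⟩

/-- Without leak witnesses, the words are approximated by elements of the extended Markov monoid
with a uniform lower bound on the probabilities of their transitions. -/
theorem exists_uniform_lower_bound [Finite A]
    (hno : ¬ ∃ p ∈ 𝒜.extendedMarkovMonoid, LimitWord.IsLeakWitness p) :
    ∃ c : ℝ, 0 < c ∧ ∀ w : List A, ∃ p, 𝒜.MemExtended p ∧ (𝒜.wordMatrix w).HasSupport p.2 ∧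
      ∀ s t, p.1.edge s t → c ≤ 𝒜.wordMatrix w s t := by
  obtain ⟨c, hc0, hc1, hc⟩ := exists_pos_le_of_finite fun x : A × Q × Q => 𝒜.trans x.1 x.2.1 x.2.2
  obtain ⟨K, hK⟩ := FactorizationForest.exists_uniform_cost LimitWord.isIteration_extendedIterate
    (costedEval_boundedBelow hno hc0 hc1)
  refine ⟨c ^ 2 ^ K, by positivity, fun w => ?_⟩
  by_cases hw : w = []
  · subst hw
    refine ⟨1, .one, by simpa [wordMatrix] using hasSupport_one, fun s t hst => ?_⟩
    obtain rfl : s = t := hst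
    simpa [wordMatrix] using pow_le_one₀ hc0.le hc1
  obtain ⟨p, hp⟩ := hK (w.map fun a => (𝒜.trans a, 𝒜.letter a, 𝒜.letter a)) (by simpa) (by
    intro x hx
    obtain ⟨a, -, rfl⟩ := List.mem_map.mp hx
    refine ⟨.letter a, 𝒜.trans_stochastic a, 𝒜.hasSupport_letter a, fun s t hst => ?_⟩
    simpa using hc (a, s, t) hst)
  have hprod : (w.map fun a => (𝒜.trans a, 𝒜.letter a, 𝒜.letter a)).prod.1 = 𝒜.wordMatrix w := by
    rw [← MonoidHom.coe_fst, map_list_prod, List.map_map]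
    rfl
  rw [hprod] at hp
  exact ⟨p, hp.mem, hp.hasSupport, hp.le⟩

theorem leaktight_of_no_leak_witness [Finite A]
    (hno : ¬ ∃ p ∈ 𝒜.extendedMarkovMonoid, LimitWord.IsLeakWitness p) : 𝒜.Leaktight := by
  rintro ⟨w, r, q, hidem, P, hlim, hr, hrq, hqr⟩
  obtain ⟨c, hc0, hc⟩ := exists_uniform_lower_bound hno
  choose p hp hsupp hle using fun n => hc (w n)
  obtain ⟨⟨u, v⟩, hinf⟩ := Finite.exists_infinite_fiber p
  have hfreq : ∃ᶠ n in atTop, p n = (u, v) :=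
    Nat.frequently_atTop_iff_infinite.mpr (Set.infinite_coe_iff.mp hinf)
  have hPs : P ∈ rowStochastic ℝ Q := by
    refine isClosed_rowStochastic.mem_of_tendsto (b := atTop) (f := fun n => 𝒜.wordMatrix (w n)) ?_
      (.of_forall fun n => 𝒜.wordMatrix_mem _)
    exact tendsto_pi_nhds.mpr fun s => tendsto_pi_nhds.mpr fun t => hlim s t
  obtain ⟨n₀, hn₀⟩ := hfreq.exists
  have hmem : 𝒜.MemExtended (u, v) := hn₀ ▸ hp n₀
  have hv : IsIdempotentElem v :=
    (𝒜.isIdempotentWord_iff (by simpa [hn₀] using hsupp n₀)).mp (hidem n₀)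
  have hrqv : v.edge r q := by simpa [hn₀] using (hsupp n₀ r q).mp (hrq n₀)
  have huP : ∀ s t, u.edge s t → 0 < P s t := fun s t hst =>
    hc0.trans_le <| ge_of_tendsto_of_frequently (hlim s t) <| hfreq.mono fun n hn =>
      hle n s t (by simpa [hn] using hst)
  have hPv : ∀ s t, 0 < P s t → v.edge s t := fun s t hst => by
    obtain ⟨n, hn, hpos⟩ := (hfreq.and_eventually ((hlim s t).eventually_const_lt hst)).exists
    simpa [hn] using (hsupp n s t).mp hpos
  -- Only `v` is known to be idempotent; a power repairs `u` and leaves `v` unchanged.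
  obtain ⟨m, hm, hu⟩ := FactorizationForest.exists_pow_isIdempotentElem u
  have hvm : v ^ m = v := by
    obtain ⟨m, rfl⟩ := Nat.exists_eq_succ_of_ne_zero hm.ne'
    exact hv.pow_succ_eq m
  have hmem' : (u ^ m, v) ∈ 𝒜.extendedMarkovMonoid := by
    have := pow_mem (S := 𝒜.extendedMarkovMonoid) (x := (u, v)) hmem m
    rwa [Prod.pow_mk, hvm] at this
  -- The state `r` is recurrent for `P` but perhaps not for `u ^ m`. It is replaced by a recurrent
  -- `r'` reachable from it, which leads back to `r` in the chain `P`, hence along `v`.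
  obtain ⟨r', hr', hrec⟩ := LimitWord.exists_edge_recurrent hu r
  have hrr' : ChainReachable P r r' := LimitWord.chainReachable_of_pow_edge hPs huP hr'
  have hr'r : ChainReachable P r' r := hr r' hrr'
  refine hno ⟨_, hmem', Prod.ext hu hv, r', q, hrec, ?_, fun hq => hqr ?_⟩
  · rcases hr'r.eq_or_edge hPs hv hPv with rfl | h
    · exact hrqv
    · exact LimitWord.edge_trans hv h hrqv
  · exact (LimitWord.chainReachable_of_pow_edge hPs huP hq).trans hPs hr'r

theorem MemExtended.of_letter_eq {ℬ : ProbAutomaton Q A} (h : 𝒜.letter = ℬ.letter)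
    {p : LimitWord Q × LimitWord Q} (hp : 𝒜.MemExtended p) : ℬ.MemExtended p := by
  induction hp with
  | letter a =>
    rw [h]
    exact .letter a
  | one => exact .one
  | mul _ _ ih ih' => exact ih.mul ih'
  | iterate hu hv _ ih => exact .iterate hu hv ih

theorem leaktight_iff [Finite A] (𝒜 : ProbAutomaton Q A) :
    𝒜.Leaktight ↔ ¬ ∃ p ∈ 𝒜.extendedMarkovMonoid, LimitWord.IsLeakWitness p :=
  ⟨fun h ⟨_, hp, hw⟩ => not_leaktight_of_isLeakWitness hp hw h, leaktight_of_no_leak_witness⟩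

end ProbAutomaton

theorem mainTheorem4 {Q A : Type*} [Fintype Q] [DecidableEq Q] [Finite A] :
    (∀ 𝒜 : ProbAutomaton Q A,
      𝒜.Leaktight ↔ ¬ ∃ p ∈ 𝒜.extendedMarkovMonoid, LimitWord.IsLeakWitness p) ∧
    (∀ 𝒜 ℬ : ProbAutomaton Q A,
      (∀ a s t, 0 < 𝒜.trans a s t ↔ 0 < ℬ.trans a s t) → (𝒜.Leaktight ↔ ℬ.Leaktight)) := by
  refine ⟨ProbAutomaton.leaktight_iff, fun 𝒜 ℬ h => ?_⟩
  have hletter : 𝒜.letter = ℬ.letter := by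
    ext a s t
    exact h a s t
  rw [𝒜.leaktight_iff, ℬ.leaktight_iff]
  exact not_congr <| exists_congr fun p => and_congr_left' ⟨fun hp => hp.of_letter_eq hletter,
    fun hp => hp.of_letter_eq hletter.symm⟩
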